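/- A \emph{numerical function} between finitely generated free abelian groups is a function that is given, in coordinates, by polynomials with rational coefficients; $\mathcal N\!um$ is the category of finitely generated free abelian groups and numerical functions. A \emph{special tower} of a simplicial object $X$ of $\mathcal N\!um$ is a tower $\cdots\to X^{n+1}\to X^n\to\cdots\to X^0=*$ in $s(\mathcal N\!um)$ with inverse limit $X$ such that every $X^n_0$ is a point; for every $j$ the map $X^{n+1}_j\to X^n_j$ is an isomorphism for all large $n$; every $X^{n+1}\to X^n$ is a principal twisted cartesian product in $\mathcal N\!um$ with fibre $\Gamma(M^n)$, where $M^n$ is a non-negatively graded chain complex of finitely generated free abelian groups and $\Gamma$ is the Dold--Kan functor; and for every $n$ there are integers $h_n\ge 1$, $i_n\ge 0$ such that $H_k(M^n)=0$ for $k\ne h_n$ and $H_{h_n}(M^n)\cong \pi^{i_n}_{h_n}(X)/\pi^{i_n+1}_{h_n}(X)$. Here $\pi_m^0(X)=\pi_m(X)$ and $\pi_m^{i+1}(X)=\langle \gamma(x)x^{-1} : x\in\pi_m^i(X),\ \gamma\in\pi_1(X)\rangle$. Let $g(A)$ be the minimal number of generators of a finitely generated abelian group $A$, and let $T$ be the function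 with $\operatorname{rk}\Gamma(C)_j=T\big((\operatorname{rk}C_k)_k\big)(j)$ for complexes $C$ of finitely generated free abelian groups. If $X$ has a special tower, then $X$ is called a \emph{minimal} numerical space, and its special towers \emph{minimal towers}, if $\operatorname{rk}X_j=\sum_{m\ge1}T(\tau_m)(j)$ for all $j$, where $\tau_m(m)=\sum_i g\big(\pi^i_m(X)/\pi^{i+1}_m(X)\big)$, $\tau_m(m+1)=\sum_i g\big(\mathrm{tors}(\pi^i_m(X)/\pi^{i+1}_m(X))\big)$, and $\tau_m(k)=0$ for $k\ne m,m+1$. Finally, $X$ is \emph{simple} if $\pi_1(X)$ acts trivially on $\pi_m(X)$ for all $m\ge1$. \textbf{Proposition.} Let $X$ and $Y$ be simple minimal numerical spaces with minimal towers $X^\cdot$ and $Y^\cdot$, whose layers $\Gamma(M^n)$ (the fibre of $X^{n+1}\to X^n$) and $\Gamma(N^n)$ (the fibre of $Y^{n+1}\to Y^n$) belong to the degrees $h^X_n$ and $h^Y_n$, and let $f\colon X\to Y$ be a map in $s(\mathcal N\!um)$. (1) Suppose that the towers are compatibly ordered as Postnikov towers: $h^Y_k<h^X_j$ whenever $k<j$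 (for example $h^X_n=h^Y_n=n+1$ for all $n$, where layers may be trivial; or, more generally, $h^X=h^Y$ strictly increasing). Then $f$ induces a unique map of towers $f^\cdot\colon X^\cdot\to Y^\cdot$: there is exactly one family of maps $f^n\colon X^n\to Y^n$ in $s(\mathcal N\!um)$ that commutes with the maps of the towers and with the projections $X\to X^n$, $Y\to Y^n$ and $f$. (2) More generally, for arbitrarily indexed minimal towers and any $a,b\ge0$ such that $h^Y_k<h^X_j$ whenever $k<b$ and $j\ge a$, there is exactly one map $\varphi\colon X^a\to Y^b$ in $s(\mathcal N\!um)$ such that the composite $X\to X^a\xrightarrow{\varphi}Y^b$ equals $X\xrightarrow{f}Y\to Y^b$. -/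

import Mathlib

open CategoryTheory Opposite

/-! ### Numerical functions and the category they form -/

/-- A function between finitely generated free abelian groups is numerical if, for a choice of
isomorphisms with `ℤ^m` and `ℤ^n`, it is given by polynomials with rational coefficients. -/
def IsNumerical {M N : Type} [AddCommGroup M] [AddCommGroup N] (f : M → N) : Prop :=
  ∃ (m n : ℕ) (e : (Fin m → ℤ) ≃+ M) (e' : N ≃+ (Fin n → ℤ))
    (P : Fin n → MvPolynomial (Fin m) ℚ),
    ∀ (x : Fin m → ℤ) (j : Fin n),
      ((e' (f (e x)) j : ℤ) : ℚ) = MvPolynomial.eval (fun k => (x k : ℚ)) (P j)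

lemma exists_addEquiv_of_free (M : Type) [AddCommGroup M] [Module.Free ℤ M] [Module.Finite ℤ M] :
    ∃ m : ℕ, Nonempty ((Fin m → ℤ) ≃+ M) :=
  ⟨_, ⟨(Module.finBasis ℤ M).equivFun.symm.toAddEquiv⟩⟩

lemma exists_linear_polynomial {m : ℕ} (l : (Fin m → ℤ) →+ ℤ) :
    ∃ P : MvPolynomial (Fin m) ℚ, ∀ x : Fin m → ℤ,
      ((l x : ℤ) : ℚ) = MvPolynomial.eval (fun k => (x k : ℚ)) P := by
  refine ⟨∑ k, MvPolynomial.C ((l (Pi.single k 1) : ℤ) : ℚ) * MvPolynomial.X k, fun x => ?_⟩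
  have hx : x = ∑ k, x k • (Pi.single k 1 : Fin m → ℤ) := by
    ext i
    simp [Finset.sum_apply, Pi.single_apply]
  conv_lhs => rw [hx]
  simp only [map_sum, map_zsmul, smul_eq_mul, Int.cast_sum, Int.cast_mul, map_mul,
    MvPolynomial.eval_C, MvPolynomial.eval_X]
  exact Finset.sum_congr rfl fun k _ => mul_comm _ _

/-- A homomorphism of finitely generated free abelian groups is numerical. -/
lemma IsNumerical.of_addMonoidHom {M N : Type} [AddCommGroup M] [AddCommGroup N]
    [Module.Free ℤ M] [Module.Finite ℤ M] [Module.Free ℤ N] [Module.Finite ℤ N]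
    (f : M →+ N) : IsNumerical f := by
  obtain ⟨m, ⟨e⟩⟩ := exists_addEquiv_of_free M
  obtain ⟨n, ⟨e'⟩⟩ := exists_addEquiv_of_free N
  choose P hP using fun j : Fin n => exists_linear_polynomial
    ((Pi.evalAddMonoidHom (fun _ : Fin n => ℤ) j).comp
      ((e'.symm : N →+ (Fin n → ℤ)).comp (f.comp (e : (Fin m → ℤ) →+ M))))
  exact ⟨m, n, e, e'.symm, P, fun x j => hP j x⟩

lemma IsNumerical.comp {M N L : Type} [AddCommGroup M] [AddCommGroup N] [AddCommGroup L]
    {g : N → L} {f : M → N} (hg : IsNumerical g) (hf : IsNumerical f) :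
    IsNumerical (fun x => g (f x)) := by
  obtain ⟨m, n, e, e', P, hP⟩ := hf
  obtain ⟨m₁, n₁, e₁, e₁', Q, hQ⟩ := hg
  choose R hR using fun i : Fin m₁ => exists_linear_polynomial
    ((Pi.evalAddMonoidHom (fun _ : Fin m₁ => ℤ) i).comp
      ((e₁.symm : N →+ (Fin m₁ → ℤ)).comp (e'.symm : (Fin n → ℤ) →+ N)))
  refine ⟨m, n₁, e, e₁', fun j => MvPolynomial.bind₁ (fun i => MvPolynomial.bind₁ P (R i)) (Q j),
    fun x j => ?_⟩
  have h₁ : ∀ i, ((e₁.symm (f (e x)) i : ℤ) : ℚ) =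
      MvPolynomial.eval (fun k => (x k : ℚ)) (MvPolynomial.bind₁ P (R i)) := by
    intro i
    have := hR i (e' (f (e x)))
    simp only [AddMonoidHom.comp_apply, Pi.evalAddMonoidHom_apply, AddMonoidHom.coe_coe,
      AddEquiv.symm_apply_apply] at this
    rw [this, ← MvPolynomial.aeval_eq_eval, ← MvPolynomial.aeval_eq_eval,
      MvPolynomial.aeval_bind₁]
    congr 2
    funext k
    exact hP x k
  have h₂ := hQ (e₁.symm (f (e x))) j
  rw [AddEquiv.apply_symm_apply] at h₂
  rw [h₂, ← MvPolynomial.aeval_eq_eval, ← MvPolynomial.aeval_eq_eval, MvPolynomial.aeval_bind₁]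
  congr 2
  funext i
  exact h₁ i

/-- The objects of the category `Num`: finitely generated free abelian groups. -/
structure NumCat : Type 1 where
  carrier : Type
  [addCommGroup : AddCommGroup carrier]
  [free : Module.Free ℤ carrier]
  [finite : Module.Finite ℤ carrier]

namespace NumCat

instance : CoeSort NumCat Type := ⟨NumCat.carrier⟩

attribute [instance] addCommGroup free finite

/-- The morphisms of `Num`: numerical functions. -/
@[ext]
structure Hom (M N : NumCat) : Type where
  toFun : M → N
  isNumerical : IsNumerical toFun

instance : Category NumCat where
  Hom := Hom
  id M := ⟨fun x => x, IsNumerical.of_addMonoidHom (AddMonoidHom.id M)⟩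
  comp f g := ⟨fun x => g.toFun (f.toFun x), g.isNumerical.comp f.isNumerical⟩

/-- The forgetful functor from `Num` to sets. -/
def forgetToType : NumCat ⥤ Type where
  obj M := M
  map f := TypeCat.ofHom (Hom.toFun f)

end NumCat

/-- The simplicial set underlying a numerical simplicial object. -/
def underlyingSSet (X : SimplicialObject NumCat) : SSet.{0} :=
  X ⋙ NumCat.forgetToType

/-- The base point of (the simplicial set underlying) `X`. It is used only when `X_0` is a
point, and then it is the unique vertex. -/
def baseVertex (X : SimplicialObject NumCat) : (underlyingSSet X).obj (op (SimplexCategory.mk 0)) :=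
  (0 : X.obj (op (SimplexCategory.mk 0)))

/-! ### Homotopy groups and the action of the fundamental group -/

section Homotopy

open MonoidalCategory CartesianMonoidalCategory

variable (S : SSet.{0}) (x₀ : S.obj (op (SimplexCategory.mk 0)))

/-- The homotopy group `π_m(S, x₀)`, `m ≥ 1`, of a pointed Kan complex: its elements are
represented by the `m`-simplices all of whose faces are at the base point, and its multiplication
table is given by the `(m+1)`-simplices with three consecutive faces `g`, `fg`, `f` all of whose
other faces are at the base point. (By the homotopy addition theorem it does not matter which
consecutive faces are used.) The group is presented by this multiplication table; for a Kan complex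
the table is that of a group, the usual homotopy group. -/
abbrev SimplicialPi (m : ℕ) : Type :=
  PresentedGroup {w : FreeGroup (S.PtSimplex m x₀) |
    ∃ (f g fg : S.PtSimplex m x₀) (i : Fin m), Nonempty (SSet.PtSimplex.MulStruct f g fg i) ∧
      w = FreeGroup.of f * FreeGroup.of g * (FreeGroup.of fg)⁻¹}

variable {S x₀} in
/-- The class in the homotopy group of a simplex whose faces are at the base point. -/
def SimplicialPi.mk {m : ℕ} (x : S.PtSimplex m x₀) : SimplicialPi S x₀ m :=
  PresentedGroup.of x

variable {S x₀} in
/-- `y` is obtained from `x` by the action of the loop `γ`: there is a homotopy from `x` to `y`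
whose restriction to the boundary of the simplex runs along `γ`. -/
def IsTransport {m : ℕ} (γ : S.PtSimplex 1 x₀) (x y : S.PtSimplex m x₀) : Prop :=
  ∃ h : SSet.stdSimplex.obj (SimplexCategory.mk m) ⊗
      SSet.stdSimplex.obj (SimplexCategory.mk 1) ⟶ S,
    SSet.ι₀ ≫ h = x.map ∧ SSet.ι₁ ≫ h = y.map ∧
      (SSet.boundary m).ι ▷ _ ≫ h = snd _ _ ≫ γ.map

/-- The subgroups `π_m^i` of `π_m`: `π_m^0 = π_m`, and `π_m^{i+1}` is generated by the elements
`γ(x)x⁻¹` with `x` in `π_m^i` and `γ` in `π_1`. -/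
def piFiltration (m : ℕ) : ℕ → Subgroup (SimplicialPi S x₀ m)
  | 0 => ⊤
  | i + 1 => Subgroup.closure {w |
      ∃ (γ : S.PtSimplex 1 x₀) (x y : S.PtSimplex m x₀),
        SimplicialPi.mk x ∈ piFiltration m i ∧ IsTransport γ x y ∧
          w = SimplicialPi.mk y * (SimplicialPi.mk x)⁻¹}

/-- The quotient `π_m^i / π_m^{i+1}`. (The subgroup that is divided out is normal for a Kan
complex, so that passing to its normal closure changes nothing.) -/
abbrev piGraded (m i : ℕ) : Type :=
  piFiltration S x₀ m i ⧸ Subgroup.normalClosure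
    ((piFiltration S x₀ m (i + 1)).subgroupOf (piFiltration S x₀ m i) :
      Set (piFiltration S x₀ m i))

/-- The pointed connected space `S` is simple: `π_1` acts trivially on `π_m` for all `m ≥ 1`. -/
def IsSimpleSpace : Prop :=
  ∀ m : ℕ, 1 ≤ m → ∀ (γ : S.PtSimplex 1 x₀) (x y : S.PtSimplex m x₀),
    IsTransport γ x y → SimplicialPi.mk x = SimplicialPi.mk y

open Classical in
/-- The minimal number of generators of a finitely generated group. -/
noncomputable def minGenerators (G : Type) [Group G] : ℕ :=
  if _h : Group.FG G then Group.rank G else 0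

/-- `g_m = ∑_i g(π_m^i / π_m^{i+1})`. -/
noncomputable def piGenCount (m : ℕ) : ℕ :=
  ∑ᶠ i : ℕ, minGenerators (piGraded S x₀ m i)

/-- `h_m = ∑_i g(torsion(π_m^i / π_m^{i+1}))`. -/
noncomputable def piTorsionGenCount (m : ℕ) : ℕ :=
  ∑ᶠ i : ℕ, minGenerators (Subgroup.closure {x : piGraded S x₀ m i | IsOfFinOrder x})

end Homotopy

/-! ### Principal twisted cartesian products -/

section Simplicial

open Simplicial

/-- The simplicial abelian group `Γ(M)` associated with a chain complex by the Dold-Kan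
correspondence. -/
noncomputable abbrev dkGamma (M : ChainComplex AddCommGrpCat.{0} ℕ) :
    SimplicialObject AddCommGrpCat.{0} :=
  Abelian.DoldKan.Γ.obj M

/-- `M` is a complex of finitely generated free abelian groups. -/
def IsFreeComplex (M : ChainComplex AddCommGrpCat.{0} ℕ) : Prop :=
  ∀ i : ℕ, Module.Free ℤ (M.X i) ∧ Module.Finite ℤ (M.X i)

/-- The structure of a principal twisted cartesian product with (abelian) structure group `G` in
the category `Num` on a map `p : E ⟶ B` of numerical simplicial objects: a twisting function `τ`
and isomorphisms `E_q ≅ G_q × B_q`, all numerical, under which `p` is the projection, and the face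
and degeneracy maps are those of the product, except for `∂_0 (g, b) = (τ(b) + ∂_0 g, ∂_0 b)`. -/
structure PTCP {E B : SimplicialObject NumCat} (p : E ⟶ B)
    (G : SimplicialObject AddCommGrpCat.{0}) where
  τ : ∀ q : ℕ, B _⦋q + 1⦌ → G _⦋q⦌
  τ_numerical : ∀ q, IsNumerical (τ q)
  δ_zero_τ : ∀ (q : ℕ) (b : B _⦋q + 2⦌),
    G.δ 0 (τ (q + 1) b) = -τ q ((B.δ 0).toFun b) + τ q ((B.δ 1).toFun b)
  δ_succ_τ : ∀ (q : ℕ) (i : Fin (q + 1)) (b : B _⦋q + 2⦌),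
    G.δ i.succ (τ (q + 1) b) = τ q ((B.δ i.succ.succ).toFun b)
  σ_τ : ∀ (q : ℕ) (i : Fin (q + 1)) (b : B _⦋q + 1⦌),
    G.σ i (τ q b) = τ (q + 1) ((B.σ i.succ).toFun b)
  τ_σ_zero : ∀ (q : ℕ) (b : B _⦋q⦌), τ q ((B.σ 0).toFun b) = 0
  θ : ∀ q : ℕ, E _⦋q⦌ ≃ G _⦋q⦌ × B _⦋q⦌
  θ_numerical : ∀ q, IsNumerical (θ q)
  θ_symm_numerical : ∀ q, IsNumerical (θ q).symm
  θ_snd : ∀ (q : ℕ) (e : E _⦋q⦌), (θ q e).2 = (p.app (op ⦋q⦌)).toFun e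
  δ_zero : ∀ (q : ℕ) (e : E _⦋q + 1⦌), θ q ((E.δ 0).toFun e) =
    (τ q (θ (q + 1) e).2 + G.δ 0 (θ (q + 1) e).1, (B.δ 0).toFun (θ (q + 1) e).2)
  δ_succ : ∀ (q : ℕ) (i : Fin (q + 1)) (e : E _⦋q + 1⦌), θ q ((E.δ i.succ).toFun e) =
    (G.δ i.succ (θ (q + 1) e).1, (B.δ i.succ).toFun (θ (q + 1) e).2)
  σ_comm : ∀ (q : ℕ) (i : Fin (q + 1)) (e : E _⦋q⦌), θ (q + 1) ((E.σ i).toFun e) =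
    (G.σ i (θ q e).1, (B.σ i).toFun (θ q e).2)

/-! ### Towers -/

/-- A presentation of `X` as a fibred numerical space: a tower `⋯ ⟶ X^{n+1} ⟶ X^n ⟶ ⋯ ⟶ X^0 = *`
with inverse limit `X`, in which each `X^n` has one vertex, which is stationary in each simplicial
degree, and in which `X^{n+1} ⟶ X^n` is a principal twisted cartesian product with fibre `Γ(M^n)`
for a complex `M^n` of finitely generated free abelian groups. -/
structure FibredTower (X : SimplicialObject NumCat) where
  tower : ℕᵒᵖ ⥤ SimplicialObject NumCat
  cone : (Functor.const ℕᵒᵖ).obj X ⟶ tower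
  isLimit : Nonempty (Limits.IsLimit (Limits.Cone.mk X cone))
  vertex : ∀ n : ℕ, Subsingleton ((tower.obj (op n)) _⦋0⦌)
  stationary : ∀ j : ℕ, ∃ N : ℕ, ∀ n : ℕ, N ≤ n →
    IsIso ((tower.map (homOfLE (Nat.le_succ n)).op).app (op ⦋j⦌))
  M : ℕ → ChainComplex AddCommGrpCat.{0} ℕ
  free : ∀ n : ℕ, IsFreeComplex (M n)
  ptcp : ∀ n : ℕ, Nonempty (PTCP (tower.map (homOfLE (Nat.le_succ n)).op) (dkGamma (M n)))
  bottom : ∀ j : ℕ, Subsingleton ((tower.obj (op 0)) _⦋j⦌)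

namespace FibredTower

variable {X : SimplicialObject NumCat} (T : FibredTower X)

/-- The stage `X^n` of the tower. -/
abbrev stage (n : ℕ) : SimplicialObject NumCat := T.tower.obj (op n)

/-- The projection `X ⟶ X^n`. -/
abbrev proj (n : ℕ) : X ⟶ T.stage n := T.cone.app (op n)

end FibredTower

/-- A special tower: the homology of `M^n` is concentrated in a single degree `h_n ≥ 1`, where it
is isomorphic to `π_{h_n}^{i_n}(X) / π_{h_n}^{i_n + 1}(X)` for some `i_n`. -/
structure SpecialTower (X : SimplicialObject NumCat) extends FibredTower X where
  h : ℕ → ℕ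
  i : ℕ → ℕ
  h_pos : ∀ n, 1 ≤ h n
  homology_eq_zero : ∀ n k : ℕ, k ≠ h n → Limits.IsZero ((M n).homology k)
  homology_iso : ∀ n : ℕ, Nonempty
    (Additive (piGraded (underlyingSSet X) (baseVertex X) (h n) (i n)) ≃+ (M n).homology (h n))

/-- The function `T` with `rk Γ(C)_j = T(rk C_0, rk C_1, …)(j)`: the group `Γ(C)_j` is the direct
sum of the `C_k` over the surjections `[j] ↠ [k]` of the simplex category. -/
noncomputable def gammaRank (r : ℕ → ℕ) (j : ℕ) : ℕ :=
  ∑ A : SimplicialObject.Splitting.IndexSet (op ⦋j⦌), r A.1.unop.len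

/-- The ranks `τ_i` of a minimal complex for the degree `i`: `g_i(X)` in degree `i`, `h_i(X)` in
degree `i + 1`, and zero elsewhere. -/
noncomputable def minimalRanks (X : SimplicialObject NumCat) (i : ℕ) : ℕ → ℕ := fun j =>
  if j = i then piGenCount (underlyingSSet X) (baseVertex X) i
  else if j = i + 1 then piTorsionGenCount (underlyingSSet X) (baseVertex X) i
  else 0

/-- `X` is a minimal special numerical space: it has a special tower, and the rank of `X_j` is
`∑_{i ≥ 1} T(τ_i)(j)` for all `j`. -/
def IsMinimalSpace (X : SimplicialObject NumCat) : Prop :=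
  Nonempty (SpecialTower X) ∧ ∀ j : ℕ,
    Module.finrank ℤ (X _⦋j⦌) = ∑ᶠ i : ℕ, gammaRank (minimalRanks X (i + 1)) j

end Simplicial

/-! The key fact is that minimality forces every complex M^n of a special tower of a simple space to
vanish outside the degrees h_n and h_n + 1 (`SpecialTower.isZero_M_X`). This is a rank count. The
rank of X_j is the sum over the layers of rk Γ(M^n)_j, because numerical bijections with numerical
inverse preserve rank. If π_m is nonzero, simplicity makes it the only nonzero quotient of its
filtration, so some layer has π_m as homology, and the ranks of that layer are at least those of
τ_m. Minimality says that the sums agree, so the chosen layers have exactly the ranks τ_m and all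
other layers vanish.

Now let H be the largest h^Y_k with k < b, so that h^X_j > H for j ≥ a. The layers of X above stage
a vanish in dimensions ≤ H, so X → X^a is injective there. On the other side, a simplex of dimension
> h in a layer Γ(N) of degree h is determined by its faces: a difference with zero faces is a cycle,
hence a boundary, of a chain that can only be zero. Climbing the tower, a simplex of Y^b is
determined by its faces of dimension ≤ H (`FibredTower.stage_ext`). Hence simplices of X with the
same image in X^a have the same image in Y^b. Since X → X^a has a numerical section in each
dimension, the induced function is numerical, and it is simplicial and unique by cancelling split
epimorphisms (`existsUnique_factorization`). -/

/-! ### Fillers and ranks in Γ(M) -/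

section DoldKan
open Simplicial AlgebraicTopology Limits

/-- The inclusion of the normalized Moore complex. -/
noncomputable def mooreInclusion (G : SimplicialObject AddCommGrpCat.{0}) (n : ℕ) :
    ((normalizedMooreComplex AddCommGrpCat.{0}).obj G).X n ⟶ G _⦋n⦌ :=
  (NormalizedMooreComplex.objX G n).arrow

lemma mooreInclusion_injective (G : SimplicialObject AddCommGrpCat.{0}) (n : ℕ) :
    Function.Injective (mooreInclusion G n) :=
  (AddCommGrpCat.mono_iff_injective _).1
    (inferInstanceAs (Mono (NormalizedMooreComplex.objX G n).arrow))

lemma exists_mooreInclusion_eq (G : SimplicialObject AddCommGrpCat.{0}) (q : ℕ)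
    (u : G _⦋q + 1⦌) (hu : ∀ i : Fin (q + 1), G.δ i.succ u = 0) :
    ∃ u' : ((normalizedMooreComplex AddCommGrpCat.{0}).obj G).X (q + 1),
      mooreInclusion G (q + 1) u' = u := by
  -- The element u is treated as a morphism from ℤ, so that the universal property of the subobject
  -- applies; evaluating at 1 recovers u.
  let φ : AddCommGrpCat.of ℤ ⟶ G _⦋q + 1⦌ := AddCommGrpCat.ofHom (zmultiplesHom _ u)
  have hφ : (NormalizedMooreComplex.objX G (q + 1)).Factors φ := by
    refine (Subobject.finset_inf_factors _).mpr fun i _ => kernelSubobject_factors _ _ ?_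
    ext
    simpa [φ] using hu i
  refine ⟨(Subobject.factorThru _ φ hφ) (1 : ℤ), ?_⟩
  exact (ConcreteCategory.congr_hom (Subobject.factorThru_arrow _ φ hφ) (1 : ℤ)).trans
    (one_zsmul u)

lemma mooreInclusion_succ_face (G : SimplicialObject AddCommGrpCat.{0}) (q : ℕ)
    (u : ((normalizedMooreComplex AddCommGrpCat.{0}).obj G).X (q + 1)) (i : Fin (q + 1)) :
    G.δ i.succ (mooreInclusion G (q + 1) u) = 0 := by
  have h : mooreInclusion G (q + 1) ≫ G.δ i.succ = 0 := by
    change (Finset.univ.inf fun k : Fin (q + 1) => kernelSubobject (G.δ k.succ)).arrow ≫ _ = 0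
    rw [← Subobject.factorThru_arrow _ _ (Subobject.finset_inf_arrow_factors Finset.univ _ i
      (by simp)), Category.assoc, kernelSubobject_arrow_comp, comp_zero]
  exact ConcreteCategory.congr_hom h u

lemma mooreInclusion_d (G : SimplicialObject AddCommGrpCat.{0}) (q : ℕ)
    (u : ((normalizedMooreComplex AddCommGrpCat.{0}).obj G).X (q + 1)) :
    mooreInclusion G q (((normalizedMooreComplex AddCommGrpCat.{0}).obj G).d (q + 1) q u) =
      G.δ 0 (mooreInclusion G (q + 1) u) := by
  have h : ((normalizedMooreComplex AddCommGrpCat.{0}).obj G).d (q + 1) q ≫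
      mooreInclusion G q = mooreInclusion G (q + 1) ≫ G.δ 0 := by
    rw [normalizedMooreComplex_objD]
    cases q with
    | zero =>
      refine (Category.assoc _ _ _).trans ?_
      refine (congrArg _ ((Category.assoc _ _ _).trans
        (congrArg _ (IsIso.inv_hom_id (⊤ : Subobject (G _⦋0⦌)).arrow)))).trans ?_
      exact congrArg _ (Category.comp_id _)
    | succ n =>
      dsimp only [NormalizedMooreComplex.objD]
      exact Subobject.factorThru_arrow _ _ _
  exact ConcreteCategory.congr_hom h u

/-- The homotopy of `Γ(M)` is the homology of `M`. -/
lemma dkGamma_exists_filler (M : ChainComplex AddCommGrpCat.{0} ℕ) (q : ℕ)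
    (hM : IsZero (M.homology (q + 1))) (v : (dkGamma M) _⦋q + 1⦌)
    (hv : ∀ i : Fin (q + 2), (dkGamma M).δ i v = 0) :
    ∃ u : (dkGamma M) _⦋q + 2⦌, (dkGamma M).δ 0 u = v ∧
      ∀ i : Fin (q + 2), (dkGamma M).δ i.succ u = 0 := by
  let K := (normalizedMooreComplex AddCommGrpCat.{0}).obj (dkGamma M)
  let e : K ≅ M := Abelian.DoldKan.equivalence.counitIso.app M
  have hK : K.ExactAt (q + 1) := by
    rw [HomologicalComplex.exactAt_iff_isZero_homology]
    exact hM.of_iso ((HomologicalComplex.homologyFunctor _ _ (q + 1)).mapIso e)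
  rw [HomologicalComplex.exactAt_iff' K (q + 2) (q + 1) q (by simp) (by simp),
    ShortComplex.ab_exact_iff] at hK
  obtain ⟨v', hv'⟩ := exists_mooreInclusion_eq _ q v (fun i => hv i.succ)
  have hd : K.d (q + 1) q v' = 0 := by
    apply mooreInclusion_injective (dkGamma M) q
    rw [map_zero]
    refine (mooreInclusion_d (dkGamma M) q v').trans ?_
    rw [hv', hv]
  obtain ⟨u', hu'⟩ := hK v' hd
  refine ⟨mooreInclusion (dkGamma M) (q + 2) u', ?_, mooreInclusion_succ_face _ _ u'⟩
  refine (mooreInclusion_d (dkGamma M) (q + 1) u').symm.trans ?_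
  rw [← hv']
  exact congrArg _ hu'

/-- Such a u lies in the normalized Moore complex, which is isomorphic to M. -/
lemma dkGamma_eq_zero_of_faces (M : ChainComplex AddCommGrpCat.{0} ℕ) (q : ℕ)
    (hM : IsZero (M.X (q + 1))) (u : (dkGamma M) _⦋q + 1⦌)
    (hu : ∀ i : Fin (q + 1), (dkGamma M).δ i.succ u = 0) : u = 0 := by
  let K := (normalizedMooreComplex AddCommGrpCat.{0}).obj (dkGamma M)
  let e : K ≅ M := Abelian.DoldKan.equivalence.counitIso.app M
  have hK : IsZero (K.X (q + 1)) :=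
    hM.of_iso ((HomologicalComplex.eval _ _ (q + 1)).mapIso e)
  obtain ⟨u', rfl⟩ := exists_mooreInclusion_eq _ q u hu
  have : Subsingleton (K.X (q + 1)) := AddCommGrpCat.subsingleton_of_isZero hK
  rw [Subsingleton.elim u' (0 : K.X (q + 1))]
  exact map_zero _

lemma nonempty_dkGamma_equiv_pi (M : ChainComplex AddCommGrpCat.{0} ℕ) (j : ℕ) :
    Nonempty ((dkGamma M) _⦋j⦌ ≃+
      ∀ A : SimplicialObject.Splitting.IndexSet (op ⦋j⦌), M.X A.1.unop.len) := by
  let f : SimplicialObject.Splitting.IndexSet (op ⦋j⦌) → AddCommGrpCat.{0} :=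
    fun A => M.X A.1.unop.len
  have e : (dkGamma M) _⦋j⦌ ≅ ⨁ f := (biproduct.isoCoproduct f).symm
  exact ⟨(e ≪≫ AddCommGrpCat.biproductIsoPi f).addCommGroupIsoToAddEquiv⟩

lemma IsFreeComplex.dkGamma {M : ChainComplex AddCommGrpCat.{0} ℕ} (hM : IsFreeComplex M)
    (j : ℕ) : Module.Free ℤ ((dkGamma M) _⦋j⦌) ∧ Module.Finite ℤ ((dkGamma M) _⦋j⦌) := by
  obtain ⟨e⟩ := nonempty_dkGamma_equiv_pi M j
  have := fun i => (hM i).1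
  have := fun i => (hM i).2
  exact ⟨Module.Free.of_equiv e.symm.toIntLinearEquiv, Module.Finite.equiv e.symm.toIntLinearEquiv⟩

lemma finrank_dkGamma {M : ChainComplex AddCommGrpCat.{0} ℕ} (hM : IsFreeComplex M) (j : ℕ) :
    Module.finrank ℤ ((_root_.dkGamma M) _⦋j⦌) =
      gammaRank (fun k => Module.finrank ℤ (M.X k)) j := by
  obtain ⟨e⟩ := nonempty_dkGamma_equiv_pi M j
  have := fun i => (hM i).1
  have := fun i => (hM i).2
  rw [e.toIntLinearEquiv.finrank_eq, Module.finrank_pi_fintype]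
  rfl

lemma subsingleton_dkGamma {M : ChainComplex AddCommGrpCat.{0} ℕ} (j : ℕ)
    (h : ∀ k ≤ j, Subsingleton (M.X k)) : Subsingleton ((dkGamma M) _⦋j⦌) := by
  obtain ⟨e⟩ := nonempty_dkGamma_equiv_pi M j
  have : ∀ A : SimplicialObject.Splitting.IndexSet (op ⦋j⦌), Subsingleton (M.X A.1.unop.len) :=
    fun A => h _ (SimplexCategory.len_le_of_epi A.e)
  exact e.toEquiv.subsingleton

lemma gammaRank_mono {r s : ℕ → ℕ} (h : ∀ k, r k ≤ s k) (j : ℕ) : gammaRank r j ≤ gammaRank s j :=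
  Finset.sum_le_sum fun _ _ => h _

/-- Equality of sums with ordered terms is termwise, and the identity surjection of [j] contributes
the term of degree j. -/
lemma eq_of_gammaRank_eq {r s : ℕ → ℕ} (h : ∀ k, r k ≤ s k) (j : ℕ)
    (hj : gammaRank r j = gammaRank s j) : r j = s j :=
  (Finset.sum_eq_sum_iff_of_le (fun _ _ => h _)).1 hj
    (SimplicialObject.Splitting.IndexSet.id (op ⦋j⦌)) (Finset.mem_univ _)

lemma gammaRank_eq_zero {r : ℕ → ℕ} (j : ℕ) (h : ∀ k ≤ j, r k = 0) : gammaRank r j = 0 :=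
  Finset.sum_eq_zero fun A _ => h _ (SimplexCategory.len_le_of_epi A.e)

end DoldKan

/-! ### Rank as an invariant of numerical isomorphism -/

section NumericalRank

/-- `IsNumerical` only provides some coordinates; linear changes of coordinates give polynomials in
any prescribed ones. -/
lemma IsNumerical.exists_polynomials {M N : Type} [AddCommGroup M] [AddCommGroup N]
    {f : M → N} (hf : IsNumerical f) {m n : ℕ} (a : (Fin m → ℤ) ≃+ M) (b : N ≃+ (Fin n → ℤ)) :
    ∃ P : Fin n → MvPolynomial (Fin m) ℚ, ∀ (x : Fin m → ℤ) (j : Fin n),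
      ((b (f (a x)) j : ℤ) : ℚ) = MvPolynomial.eval (fun k => (x k : ℚ)) (P j) := by
  obtain ⟨m₀, n₀, e, e', P, hP⟩ := hf
  choose R hR using fun i : Fin m₀ => exists_linear_polynomial
    ((Pi.evalAddMonoidHom (fun _ : Fin m₀ => ℤ) i).comp (a.trans e.symm).toAddMonoidHom)
  choose S hS using fun j : Fin n => exists_linear_polynomial
    ((Pi.evalAddMonoidHom (fun _ : Fin n => ℤ) j).comp (e'.symm.trans b).toAddMonoidHom)
  refine ⟨fun j => MvPolynomial.bind₁ (fun i => MvPolynomial.bind₁ R (P i)) (S j),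
    fun x j => ?_⟩
  have h₁ : ∀ i, ((e' (f (a x)) i : ℤ) : ℚ) =
      MvPolynomial.eval (fun k => (x k : ℚ)) (MvPolynomial.bind₁ R (P i)) := by
    intro i
    have := hP (e.symm (a x)) i
    rw [AddEquiv.apply_symm_apply] at this
    rw [this, ← MvPolynomial.aeval_eq_eval, ← MvPolynomial.aeval_eq_eval,
      MvPolynomial.aeval_bind₁]
    congr 2
    funext k
    exact hR k x
  have h₂ := hS j (e' (f (a x)))
  simp only [AddMonoidHom.comp_apply, Pi.evalAddMonoidHom_apply,
    AddEquiv.toAddMonoidHom_eq_coe, AddMonoidHom.coe_coe, AddEquiv.trans_apply,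
    AddEquiv.symm_apply_apply] at h₂
  rw [h₂, ← MvPolynomial.aeval_eq_eval, ← MvPolynomial.aeval_eq_eval, MvPolynomial.aeval_bind₁]
  congr 2
  funext i
  exact h₁ i

/-- A numerical retraction induces an injection of the polynomial ring in rk M variables into that
in rk N variables; compare transcendence degrees. -/
lemma finrank_le_of_isNumerical {M N : Type} [AddCommGroup M] [AddCommGroup N]
    [Module.Free ℤ M] [Module.Finite ℤ M] [Module.Free ℤ N] [Module.Finite ℤ N]
    {f : M → N} {g : N → M} (hf : IsNumerical f) (hg : IsNumerical g) (hgf : ∀ x, g (f x) = x) :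
    Module.finrank ℤ M ≤ Module.finrank ℤ N := by
  obtain ⟨m, ⟨a⟩⟩ := exists_addEquiv_of_free M
  obtain ⟨n, ⟨b⟩⟩ := exists_addEquiv_of_free N
  obtain ⟨P, hP⟩ := hf.exists_polynomials a b.symm
  obtain ⟨Q, hQ⟩ := hg.exists_polynomials b a.symm
  -- The composite is the identity on integer points, and a rational polynomial is determined by its
  -- values there.
  have hPQ : ∀ i, MvPolynomial.bind₁ P (Q i) = MvPolynomial.X i := by
    intro i
    refine MvPolynomial.funext_set (fun _ => Set.range ((↑) : ℤ → ℚ))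
      (fun _ => Set.infinite_range_of_injective Int.cast_injective) fun x hx => ?_
    choose y hy using fun k => hx k (Set.mem_univ k)
    obtain rfl : (fun k => (y k : ℚ)) = x := funext hy
    have := hQ (b.symm (f (a y))) i
    simp only [AddEquiv.apply_symm_apply, hgf, AddEquiv.symm_apply_apply] at this
    rw [MvPolynomial.eval_X, this, ← MvPolynomial.aeval_eq_eval, ← MvPolynomial.aeval_eq_eval,
      MvPolynomial.aeval_bind₁]
    congr 2
    funext k
    exact (hP y k).symm
  have hinj : Function.Injective (MvPolynomial.bind₁ Q) := by
    refine Function.LeftInverse.injective (g := MvPolynomial.bind₁ P) fun p => ?_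
    have : (MvPolynomial.bind₁ P).comp (MvPolynomial.bind₁ Q) = AlgHom.id ℚ _ :=
      MvPolynomial.algHom_ext fun i => by simp [hPQ]
    exact DFunLike.congr_fun this p
  have h := trdeg_le_of_injective (MvPolynomial.bind₁ Q) hinj
  rw [MvPolynomial.trdeg_of_isDomain, MvPolynomial.trdeg_of_isDomain] at h
  rw [← a.toIntLinearEquiv.finrank_eq, ← b.toIntLinearEquiv.finrank_eq]
  simpa using h

lemma finrank_eq_of_isNumerical {M N : Type} [AddCommGroup M] [AddCommGroup N]
    [Module.Free ℤ M] [Module.Finite ℤ M] [Module.Free ℤ N] [Module.Finite ℤ N]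
    (e : M ≃ N) (he : IsNumerical e) (he' : IsNumerical e.symm) :
    Module.finrank ℤ M = Module.finrank ℤ N :=
  le_antisymm (finrank_le_of_isNumerical he he' e.symm_apply_apply)
    (finrank_le_of_isNumerical he' he e.apply_symm_apply)

lemma NumCat.finrank_eq_of_isIso {M N : NumCat} (f : M ⟶ N) [IsIso f] :
    Module.finrank ℤ M = Module.finrank ℤ N :=
  le_antisymm
    (finrank_le_of_isNumerical f.isNumerical (inv f).isNumerical
      fun x => congrFun (congrArg NumCat.Hom.toFun (IsIso.hom_inv_id f)) x)
    (finrank_le_of_isNumerical (inv f).isNumerical f.isNumerical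
      fun x => congrFun (congrArg NumCat.Hom.toFun (IsIso.inv_hom_id f)) x)

lemma NumCat.bijective_of_isIso {M N : NumCat} (f : M ⟶ N) [IsIso f] :
    Function.Bijective f.toFun :=
  ⟨Function.LeftInverse.injective
      fun x => congrFun (congrArg NumCat.Hom.toFun (IsIso.hom_inv_id f)) x,
    Function.RightInverse.surjective
      fun x => congrFun (congrArg NumCat.Hom.toFun (IsIso.inv_hom_id f)) x⟩

end NumericalRank

/-! ### Towers: projections and ranks -/

section Towers

open Simplicial

namespace PTCP

variable {E B : SimplicialObject NumCat} {p : E ⟶ B} {G : SimplicialObject AddCommGrpCat.{0}}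
  (P : PTCP p G)
include P

lemma isSplitEpi (q : ℕ) [Module.Free ℤ (G _⦋q⦌)] [Module.Finite ℤ (G _⦋q⦌)] :
    IsSplitEpi (p.app (op ⦋q⦌)) := by
  refine ⟨⟨⟨⟨fun b => (P.θ q).symm (0, b), (P.θ_symm_numerical q).comp
    (IsNumerical.of_addMonoidHom (AddMonoidHom.inr (G _⦋q⦌) (B _⦋q⦌)))⟩, ?_⟩⟩⟩
  refine NumCat.Hom.ext (funext fun b => ?_)
  change (p.app (op ⦋q⦌)).toFun ((P.θ q).symm (0, b)) = b
  rw [← P.θ_snd, Equiv.apply_symm_apply]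

lemma finrank_eq (q : ℕ) [Module.Free ℤ (G _⦋q⦌)] [Module.Finite ℤ (G _⦋q⦌)] :
    Module.finrank ℤ (E _⦋q⦌) = Module.finrank ℤ (G _⦋q⦌) + Module.finrank ℤ (B _⦋q⦌) := by
  rw [finrank_eq_of_isNumerical (P.θ q) (P.θ_numerical q) (P.θ_symm_numerical q),
    Module.finrank_prod]

lemma subsingleton_of_injective (q : ℕ) (h : Function.Injective (p.app (op ⦋q⦌)).toFun) :
    Subsingleton (G _⦋q⦌) := by
  refine ⟨fun g g' => ?_⟩
  have : (P.θ q).symm (g, 0) = (P.θ q).symm (g', 0) := by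
    apply h
    rw [← P.θ_snd, ← P.θ_snd, Equiv.apply_symm_apply, Equiv.apply_symm_apply]
  simpa using this

lemma ext_of_subsingleton (q : ℕ) [Subsingleton (G _⦋q⦌)] {e e' : E _⦋q⦌}
    (h : (p.app (op ⦋q⦌)).toFun e = (p.app (op ⦋q⦌)).toFun e') : e = e' := by
  apply (P.θ q).injective
  refine Prod.ext (Subsingleton.elim _ _) ?_
  rw [P.θ_snd, P.θ_snd, h]

end PTCP

namespace FibredTower

variable {X : SimplicialObject NumCat} (T : FibredTower X)

/-- The bonding map `X^{n+1} ⟶ X^n`. -/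
abbrev bond (n : ℕ) : T.stage (n + 1) ⟶ T.stage n := T.tower.map (homOfLE (Nat.le_succ n)).op

lemma proj_map {m n : ℕ} (f : op m ⟶ op n) : T.proj m ≫ T.tower.map f = T.proj n := by
  simpa using (T.cone.naturality f).symm

/-- In each dimension the tower is eventually constant, so its limit there is a late stage. -/
lemma exists_isIso_proj (j : ℕ) : ∃ N : ℕ, ∀ n, N ≤ n → IsIso ((T.proj n).app (op ⦋j⦌)) := by
  have hconst : ∀ k : SimplexCategoryᵒᵖ, ∃ N : ℕ,
      (T.tower.flip.obj k).IsEventuallyConstantTo (op N) := by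
    intro k
    obtain ⟨N, hN⟩ := T.stationary k.unop.len
    refine ⟨N, fun i f => ?_⟩
    obtain ⟨n, rfl⟩ : ∃ n, i = op n := ⟨i.unop, rfl⟩
    have hle : N ≤ n := leOfHom f.unop
    induction n, hle using Nat.le_induction with
    | base =>
      rw [Subsingleton.elim f (𝟙 _)]
      infer_instance
    | succ n hn ih =>
      have := ih (homOfLE hn).op
      have : IsIso ((T.tower.flip.obj k).map (homOfLE (Nat.le_succ n)).op) := hN n hn
      rw [show f = (homOfLE (Nat.le_succ n)).op ≫ (homOfLE hn).op from Subsingleton.elim _ _,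
        Functor.map_comp]
      infer_instance
  -- Each dimension has a limit by eventual constancy. These assemble to a limit of simplicial
  -- objects, so the given limit is also computed dimensionwise, without assuming that `NumCat` has
  -- limits.
  let c : ∀ k, Limits.LimitCone (T.tower.flip.obj k) := fun k =>
    ⟨_, (hconst k).choose_spec.isLimitCone⟩
  obtain ⟨hlim⟩ := T.isLimit
  let e := hlim.uniqueUpToIso (Limits.combinedIsLimit T.tower c)
  have hev : Limits.IsLimit (((evaluation _ _).obj (op ⦋j⦌)).mapCone
      (Limits.Cone.mk X T.cone)) :=
    (c (op ⦋j⦌)).isLimit.ofIsoLimit ((Limits.evaluateCombinedCones T.tower c (op ⦋j⦌)).symm ≪≫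
      ((Limits.Cone.functoriality _ _).mapIso e).symm)
  obtain ⟨N, hN⟩ := hconst (op ⦋j⦌)
  exact ⟨N, fun n hn => hN.isIso_π_of_isLimit' hev (op n) (homOfLE hn).op⟩

lemma free_dkGamma (n q : ℕ) : Module.Free ℤ ((dkGamma (T.M n)) _⦋q⦌) := ((T.free n).dkGamma q).1

lemma finite_dkGamma (n q : ℕ) : Module.Finite ℤ ((dkGamma (T.M n)) _⦋q⦌) :=
  ((T.free n).dkGamma q).2

lemma isSplitEpi_bond (n q : ℕ) : IsSplitEpi ((T.bond n).app (op ⦋q⦌)) := by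
  have := T.free_dkGamma n q
  have := T.finite_dkGamma n q
  exact (T.ptcp n).some.isSplitEpi q

lemma isSplitEpi_proj (a q : ℕ) : IsSplitEpi ((T.proj a).app (op ⦋q⦌)) := by
  obtain ⟨N, hN⟩ := T.exists_isIso_proj q
  -- Downward induction from the stages where the projection is an isomorphism; k bounds the
  -- distance to them.
  suffices h : ∀ k n, N ≤ n + k → IsSplitEpi ((T.proj n).app (op ⦋q⦌)) from h N a (by omega)
  intro k
  induction k with
  | zero =>
    intro n hn
    have := hN n hn
    infer_instance
  | succ k ih =>
    intro n hn
    have := ih (n + 1) (by omega)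
    have := T.isSplitEpi_bond n q
    rw [← T.proj_map (homOfLE (Nat.le_succ n)).op, NatTrans.comp_app]
    infer_instance

lemma finrank_stage (n q : ℕ) : Module.finrank ℤ ((T.stage n) _⦋q⦌) =
    ∑ i ∈ Finset.range n, gammaRank (fun k => Module.finrank ℤ ((T.M i).X k)) q := by
  induction n with
  | zero =>
    have := T.bottom q
    simpa using Module.finrank_zero_of_subsingleton
  | succ n ih =>
    have := T.free_dkGamma n q
    have := T.finite_dkGamma n q
    rw [(T.ptcp n).some.finrank_eq q, ih, Finset.sum_range_succ, add_comm,
      finrank_dkGamma (T.free n)]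

lemma exists_finrank_eq (q : ℕ) : ∃ N : ℕ, ∀ n, N ≤ n → Module.finrank ℤ (X _⦋q⦌) =
    ∑ i ∈ Finset.range n, gammaRank (fun k => Module.finrank ℤ ((T.M i).X k)) q := by
  obtain ⟨N, hN⟩ := T.exists_isIso_proj q
  refine ⟨N, fun n hn => ?_⟩
  have := hN n hn
  rw [← T.finrank_stage]
  exact NumCat.finrank_eq_of_isIso ((T.proj n).app (op ⦋q⦌))

lemma proj_injective_of_subsingleton (a q : ℕ)
    (h : ∀ n, a ≤ n → Subsingleton ((dkGamma (T.M n)) _⦋q⦌)) :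
    Function.Injective ((T.proj a).app (op ⦋q⦌)).toFun := by
  obtain ⟨N, hN⟩ := T.exists_isIso_proj q
  suffices h : ∀ k n, a ≤ n → N ≤ n + k → Function.Injective ((T.proj n).app (op ⦋q⦌)).toFun from
    h N a le_rfl (by omega)
  intro k
  induction k with
  | zero =>
    intro n _ hn
    have := hN n hn
    exact (NumCat.bijective_of_isIso _).1
  | succ k ih =>
    intro n ha hn
    have := h n ha
    rw [← T.proj_map (homOfLE (Nat.le_succ n)).op, NatTrans.comp_app]
    exact fun x y hxy => ih (n + 1) (by omega) (by omega)
      ((T.ptcp n).some.ext_of_subsingleton q hxy)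

end FibredTower

/-! ### Null homotopies along a tower and vanishing homotopy groups -/

/-- The degeneracy of the base vertex in degree `q`. -/
def basePoint (E : SimplicialObject NumCat) (q : ℕ) : E _⦋q⦌ :=
  (E.map (SimplexCategory.const ⦋q⦌ ⦋0⦌ 0).op).toFun (0 : E _⦋0⦌)

lemma map_basePoint (E : SimplicialObject NumCat) {q r : ℕ} (f : ⦋q⦌ ⟶ ⦋r⦌) :
    (E.map f.op).toFun (basePoint E r) = basePoint E q := by
  change (E.map (SimplexCategory.const ⦋r⦌ ⦋0⦌ 0).op ≫ E.map f.op).toFun _ = _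
  rw [← E.map_comp, ← op_comp]
  rfl

lemma σ_basePoint (E : SimplicialObject NumCat) (q : ℕ) (i : Fin (q + 1)) :
    (E.σ i).toFun (basePoint E q) = basePoint E (q + 1) :=
  map_basePoint E _

lemma NumCat.naturality_apply {E B : SimplicialObject NumCat} (p : E ⟶ B)
    {q r : SimplexCategoryᵒᵖ} (f : q ⟶ r) (e : E.obj q) :
    (p.app r).toFun ((E.map f).toFun e) = (B.map f).toFun ((p.app q).toFun e) :=
  congrFun (congrArg NumCat.Hom.toFun (p.naturality f)) e

lemma app_basePoint {E B : SimplicialObject NumCat} (p : E ⟶ B) [Subsingleton (B _⦋0⦌)] (q : ℕ) :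
    (p.app (op ⦋q⦌)).toFun (basePoint E q) = basePoint B q := by
  rw [basePoint, NumCat.naturality_apply]
  exact congrArg _ (Subsingleton.elim _ _)

namespace PTCP

variable {E B : SimplicialObject NumCat} {p : E ⟶ B} {G : SimplicialObject AddCommGrpCat.{0}}

lemma τ_basePoint (P : PTCP p G) (q : ℕ) : P.τ q (basePoint B (q + 1)) = 0 := by
  rw [← σ_basePoint B q 0, P.τ_σ_zero]

lemma θ_basePoint (P : PTCP p G) [Subsingleton (E _⦋0⦌)] [Subsingleton (B _⦋0⦌)] (q : ℕ) :
    P.θ q (basePoint E q) = (0, basePoint B q) := by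
  refine Prod.ext ?_ (by rw [P.θ_snd, app_basePoint])
  induction q with
  | zero =>
    have := P.subsingleton_of_injective 0 (Function.injective_of_subsingleton _)
    exact Subsingleton.elim _ _
  | succ q ih =>
    rw [← σ_basePoint E q 0, P.σ_comm, ih]
    exact map_zero _

/-- Lifting a null homotopy along a principal twisted cartesian product. -/
lemma exists_lift_nullhomotopy {M : ChainComplex AddCommGrpCat.{0} ℕ} (P : PTCP p (dkGamma M))
    [Subsingleton (E _⦋0⦌)] [Subsingleton (B _⦋0⦌)] (q : ℕ)
    (hM : Limits.IsZero (M.homology (q + 1))) (x : E _⦋q + 1⦌)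
    (hx : ∀ i : Fin (q + 2), (E.δ i).toFun x = basePoint E q) (w : B _⦋q + 2⦌)
    (hw₀ : (B.δ 0).toFun w = (p.app (op ⦋q + 1⦌)).toFun x)
    (hw : ∀ i : Fin (q + 2), (B.δ i.succ).toFun w = basePoint B (q + 1)) :
    ∃ w' : E _⦋q + 2⦌, (E.δ 0).toFun w' = x ∧
      ∀ i : Fin (q + 2), (E.δ i.succ).toFun w' = basePoint E (q + 1) := by
  have hx₂ : (P.θ (q + 1) x).2 = (B.δ 0).toFun w := by rw [P.θ_snd, hw₀]
  -- The lift is sought as (u, w). The formula for the zeroth face requires ∂_0 u to be the fibre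
  -- coordinate of x minus τ(w); the twisting identities show that this difference has zero faces.
  obtain ⟨u, hu₀, hu⟩ := dkGamma_exists_filler M q hM
    ((P.θ (q + 1) x).1 - P.τ (q + 1) w) (by
      intro i
      rw [map_sub]
      refine Fin.cases ?_ (fun i => ?_) i
      · have h := congrArg Prod.fst (P.δ_zero q x)
        rw [hx, P.θ_basePoint, hx₂] at h
        have h1 := hw 0
        rw [Fin.succ_zero_eq_one] at h1
        rw [P.δ_zero_τ, h1, P.τ_basePoint, add_zero, sub_neg_eq_add, add_comm]
        exact h.symm
      · have h := congrArg Prod.fst (P.δ_succ q i x)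
        rw [hx, P.θ_basePoint] at h
        rw [P.δ_succ_τ, hw, P.τ_basePoint, sub_zero]
        exact h.symm)
  refine ⟨(P.θ (q + 2)).symm (u, w), (P.θ (q + 1)).injective ?_,
    fun i => (P.θ (q + 1)).injective ?_⟩
  · rw [P.δ_zero, Equiv.apply_symm_apply, hu₀]
    exact Prod.ext (add_sub_cancel _ _) hx₂.symm
  · rw [P.δ_succ, Equiv.apply_symm_apply, P.θ_basePoint]
    exact Prod.ext (hu i) (hw i)

/-- Simplices of a principal twisted cartesian product with the same image in the base and the
same faces differ by a simplex of the fibre all of whose faces are trivial. -/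
lemma eq_of_faces_eq (P : PTCP p G) {q : ℕ} {e e' : E _⦋q + 1⦌}
    (h : (p.app (op ⦋q + 1⦌)).toFun e = (p.app (op ⦋q + 1⦌)).toFun e')
    (hδ : ∀ i : Fin (q + 2), (E.δ i).toFun e = (E.δ i).toFun e')
    (hG : ∀ v : G _⦋q + 1⦌, (∀ i : Fin (q + 2), G.δ i v = 0) → v = 0) : e = e' := by
  have h₂ : (P.θ (q + 1) e).2 = (P.θ (q + 1) e').2 := by rw [P.θ_snd, P.θ_snd, h]
  refine (P.θ (q + 1)).injective (Prod.ext (sub_eq_zero.1 (hG _ fun i => ?_)) h₂)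
  rw [map_sub, sub_eq_zero]
  refine Fin.cases ?_ (fun i => ?_) i
  · have h := congrArg Prod.fst (P.δ_zero q e)
    rw [hδ, P.δ_zero, h₂] at h
    exact (add_left_cancel h).symm
  · have h := congrArg Prod.fst (P.δ_succ q i e)
    rw [hδ, P.δ_succ] at h
    exact h.symm

end PTCP

/-- A simplex of `Γ(M)` of dimension `> h` with trivial faces is trivial, if the homology of `M`
vanishes above degree `h` and `M` vanishes above degree `h + 1`. -/
lemma dkGamma_eq_zero_of_all_faces (M : ChainComplex AddCommGrpCat.{0} ℕ) (q : ℕ)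
    (hM : Limits.IsZero (M.homology (q + 1))) (hM' : Limits.IsZero (M.X (q + 2)))
    (v : (dkGamma M) _⦋q + 1⦌) (hv : ∀ i : Fin (q + 2), (dkGamma M).δ i v = 0) : v = 0 := by
  obtain ⟨u, hu₀, hu⟩ := dkGamma_exists_filler M q hM v hv
  rw [← hu₀, dkGamma_eq_zero_of_faces M (q + 1) hM' u hu, map_zero]

namespace FibredTower

variable {X : SimplicialObject NumCat} (T : FibredTower X)

instance (n : ℕ) : Subsingleton ((T.stage n) _⦋0⦌) := T.vertex n

/-- A null homotopy is lifted stage by stage from the point X^0, then read in X at a stage that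
agrees with X in dimensions q + 1 and q + 2. -/
lemma exists_nullhomotopy (q : ℕ) (hM : ∀ n, Limits.IsZero ((T.M n).homology (q + 1)))
    (x : X _⦋q + 1⦌) (hx : ∀ i : Fin (q + 2), (X.δ i).toFun x = basePoint X q) :
    ∃ w : X _⦋q + 2⦌, (X.δ 0).toFun w = x ∧
      ∀ i : Fin (q + 2), (X.δ i.succ).toFun w = basePoint X (q + 1) := by
  have key : ∀ n, ∃ w : (T.stage n) _⦋q + 2⦌,
      ((T.stage n).δ 0).toFun w = ((T.proj n).app (op ⦋q + 1⦌)).toFun x ∧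
      ∀ i : Fin (q + 2), ((T.stage n).δ i.succ).toFun w = basePoint (T.stage n) (q + 1) := by
    intro n
    induction n with
    | zero =>
      have := T.bottom (q + 1)
      exact ⟨0, Subsingleton.elim _ _, fun _ => Subsingleton.elim _ _⟩
    | succ n ih =>
      obtain ⟨w, hw₀, hw⟩ := ih
      refine PTCP.exists_lift_nullhomotopy (T.ptcp n).some q (hM n) _ (fun i => ?_) w ?_ hw
      · refine (NumCat.naturality_apply (T.proj (n + 1)) _ x).symm.trans ?_
        rw [← app_basePoint (T.proj (n + 1)), ← hx i]
        rfl
      · rw [hw₀, ← T.proj_map (homOfLE (Nat.le_succ n)).op]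
        rfl
  obtain ⟨N₁, hN₁⟩ := T.exists_isIso_proj (q + 1)
  obtain ⟨N₂, hN₂⟩ := T.exists_isIso_proj (q + 2)
  let N := max N₁ N₂
  have h₁ := hN₁ N (le_max_left _ _)
  have h₂ := hN₂ N (le_max_right _ _)
  obtain ⟨w', hw₀', hw'⟩ := key N
  obtain ⟨w, rfl⟩ := (NumCat.bijective_of_isIso ((T.proj N).app (op ⦋q + 2⦌))).2 w'
  have hinj := (NumCat.bijective_of_isIso ((T.proj N).app (op ⦋q + 1⦌))).1
  refine ⟨w, hinj ?_, fun i => hinj ?_⟩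
  · rw [← hw₀']
    exact NumCat.naturality_apply (T.proj N) _ w
  · rw [app_basePoint, ← hw' i]
    exact NumCat.naturality_apply (T.proj N) _ w

end FibredTower

lemma yonedaEquiv_const_basePoint (X : SimplicialObject NumCat) (q : ℕ) :
    SSet.yonedaEquiv (SSet.const (X := Δ[q]) (baseVertex X)) = basePoint X q := rfl

lemma δ_yonedaEquiv (X : SimplicialObject NumCat) {q : ℕ} (g : Δ[q + 1] ⟶ underlyingSSet X)
    (i : Fin (q + 2)) :
    (X.δ i).toFun (SSet.yonedaEquiv g) = SSet.yonedaEquiv (SSet.stdSimplex.δ i ≫ g) :=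
  (SSet.stdSimplex.yonedaEquiv_δ_comp (X := underlyingSSet X) g i).symm

lemma FibredTower.simplicialPi_mk_eq_one {X : SimplicialObject NumCat} (T : FibredTower X) (q : ℕ)
    (hM : ∀ n, Limits.IsZero ((T.M n).homology (q + 1)))
    (x : (underlyingSSet X).PtSimplex (q + 1) (baseVertex X)) : SimplicialPi.mk x = 1 := by
  have mem : ∀ (f g fg : (underlyingSSet X).PtSimplex (q + 1) (baseVertex X))
      (_ : SSet.PtSimplex.MulStruct f g fg 0),
      SimplicialPi.mk f * SimplicialPi.mk g = SimplicialPi.mk fg := by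
    intro f g fg h
    rw [← mul_inv_eq_one]
    exact PresentedGroup.one_of_mem ⟨f, g, fg, 0, ⟨h⟩, rfl⟩
  have hconst : SimplicialPi.mk (SSet.RelativeMorphism.const :
      (underlyingSSet X).PtSimplex (q + 1) (baseVertex X)) = 1 := by
    -- The degenerate simplex gives e * e = e, so the constant simplex represents 1.
    have := mem .const .const .const
      { map := SSet.const (baseVertex X) }
    simpa using this
  obtain ⟨w, hw₀, hw⟩ := T.exists_nullhomotopy q hM (SSet.yonedaEquiv x.map) (by
    intro i
    rw [← yonedaEquiv_const_basePoint, ← SSet.PtSimplex.δ_map x i]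
    exact δ_yonedaEquiv X x.map i)
  obtain ⟨w, rfl⟩ := (SSet.yonedaEquiv (X := underlyingSSet X)).surjective w
  have hδ : ∀ i : Fin (q + 2), SSet.stdSimplex.δ i.succ ≫ w = SSet.const (baseVertex X) := by
    intro i
    apply SSet.yonedaEquiv.injective
    exact (δ_yonedaEquiv X w i.succ).symm.trans (hw i)
  -- The null homotopy has x as face 0 and all other faces constant, which is the relation 1 * [x] =
  -- 1.
  have := mem .const x .const
    { map := w
      δ_castSucc_castSucc_map := by
        apply SSet.yonedaEquiv.injective
        exact (δ_yonedaEquiv X w 0).symm.trans hw₀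
      δ_succ_castSucc_map := hδ _
      δ_succ_succ_map := hδ _
      δ_map_of_lt := fun j hj => absurd hj (Fin.not_lt_zero j)
      δ_map_of_gt := fun j hj => by
        obtain ⟨i, rfl⟩ := Fin.exists_succ_eq.2 (Fin.pos_iff_ne_zero.1
          (lt_of_le_of_lt (Fin.zero_le _) hj))
        exact hδ i }
  rwa [hconst, one_mul] at this

lemma FibredTower.subsingleton_simplicialPi {X : SimplicialObject NumCat} (T : FibredTower X)
    (q : ℕ) (hM : ∀ n, Limits.IsZero ((T.M n).homology (q + 1))) :
    Subsingleton (SimplicialPi (underlyingSSet X) (baseVertex X) (q + 1)) := by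
  suffices h : ∀ z : SimplicialPi (underlyingSSet X) (baseVertex X) (q + 1), z = 1 from
    ⟨fun a b => (h a).trans (h b).symm⟩
  intro z
  exact Subgroup.mem_bot.1 (PresentedGroup.generated_by _ ⊥
    (fun x => Subgroup.mem_bot.2 (T.simplicialPi_mk_eq_one q hM x)) z)

end Towers

/-! ### Counting generators of quotients and of torsion -/

section Generators

lemma minGenerators_le_of_surjective {G A : Type} [Group G] [AddCommGroup A] [Module.Free ℤ A]
    [Module.Finite ℤ A] (f : Multiplicative A →* G) (hf : Function.Surjective f) :
    minGenerators G ≤ Module.finrank ℤ A := by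
  classical
  let b := Module.finBasis ℤ A
  let s : Finset (Multiplicative A) := Finset.univ.image fun i => Multiplicative.ofAdd (b i)
  have hs : Subgroup.closure (s : Set (Multiplicative A)) = ⊤ := by
    refine eq_top_iff.2 fun x _ => ?_
    have hx : x = ∏ i, Multiplicative.ofAdd (b i) ^ (b.repr x.toAdd i) := by
      apply Multiplicative.toAdd.injective
      rw [toAdd_prod]
      simp [b.sum_repr]
    rw [hx]
    exact Subgroup.prod_mem _ fun i _ => Subgroup.zpow_mem _
      (Subgroup.subset_closure (by simp [s])) _
  have : Group.FG (Multiplicative A) := ⟨⟨s, hs⟩⟩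
  have hG : Group.FG G := Group.fg_of_surjective hf
  rw [minGenerators, dif_pos hG]
  calc Group.rank G ≤ Group.rank (Multiplicative A) := Group.rank_le_of_surjective f hf
    _ ≤ s.card := Group.rank_le hs
    _ ≤ Fintype.card (Fin (Module.finrank ℤ A)) := Finset.card_image_le
    _ = Module.finrank ℤ A := Fintype.card_fin _

lemma minGenerators_of_subsingleton (G : Type) [Group G] [Subsingleton G] :
    minGenerators G = 0 := by
  have := minGenerators_le_of_surjective (A := PUnit) (1 : Multiplicative PUnit →* G)
    (Function.surjective_to_subsingleton _)
  rwa [Module.finrank_zero_of_subsingleton, Nat.le_zero] at this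

lemma isOfFinOrder_iff_mem_torsion {G H : Type} [Group G] [AddCommGroup H]
    (e : Additive G ≃+ H) (x : G) :
    IsOfFinOrder x ↔ e (Additive.ofMul x) ∈ Submodule.torsion ℤ H := by
  rw [isOfFinOrder_iff_zpow_eq_one, Submodule.mem_torsion_iff]
  have h : ∀ n : ℤ, x ^ n = 1 ↔ n • e (Additive.ofMul x) = 0 := by
    intro n
    rw [← map_zsmul, map_eq_zero_iff e e.injective, ← ofMul_zpow, ofMul_eq_zero]
  constructor
  · rintro ⟨n, hn, hx⟩
    exact ⟨⟨n, mem_nonZeroDivisors_of_ne_zero hn⟩, (h n).1 hx⟩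
  · rintro ⟨n, hn⟩
    exact ⟨n, nonZeroDivisors.coe_ne_zero n, (h n).2 hn⟩

/-- The image of t is the kernel of π, and the preimage of the torsion is torsion modulo it; the two
therefore have the same rank. -/
lemma finrank_comap_torsion_le {B A H : Type} [AddCommGroup B] [AddCommGroup A] [AddCommGroup H]
    [Module.Free ℤ B] [Module.Finite ℤ B] [Module.Free ℤ A] [Module.Finite ℤ A]
    (t : B →ₗ[ℤ] A) (π : A →ₗ[ℤ] H) (h : ∀ a, π a = 0 → ∃ b, t b = a)
    (h' : ∀ b, π (t b) = 0) :
    Module.finrank ℤ ((Submodule.torsion ℤ H).comap π) ≤ Module.finrank ℤ B := by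
  let K := (Submodule.torsion ℤ H).comap π
  have hle : LinearMap.range t ≤ K := by
    rintro _ ⟨b, rfl⟩
    change π (t b) ∈ Submodule.torsion ℤ H
    rw [h']
    exact zero_mem _
  have htors : Module.IsTorsion ℤ (K ⧸ (LinearMap.range t).submoduleOf K) := by
    intro x
    obtain ⟨⟨a, ha⟩, rfl⟩ := Submodule.Quotient.mk_surjective _ x
    obtain ⟨n, hn⟩ := (Submodule.mem_torsion_iff _).1 ha
    refine ⟨n, ?_⟩
    obtain ⟨b, hb⟩ := h ((n : ℤ) • a) (by rw [map_smul]; exact hn)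
    exact (Submodule.Quotient.mk_eq_zero _).2 ⟨b, hb⟩
  have h₀ := Module.finrank_eq_zero_iff_isTorsion.2 htors
  have h₁ := Submodule.finrank_quotient_add_finrank ((LinearMap.range t).submoduleOf K)
  rw [h₀, zero_add, (Submodule.submoduleOfEquivOfLe hle).finrank_eq] at h₁
  rw [← h₁]
  exact LinearMap.finrank_range_le t

/-- The torsion is a quotient of its preimage in A, which is free of rank at most rk B. -/
lemma minGenerators_torsion_le {G B A H : Type} [Group G]
    [AddCommGroup B] [AddCommGroup A] [AddCommGroup H]
    [Module.Free ℤ B] [Module.Finite ℤ B] [Module.Free ℤ A] [Module.Finite ℤ A]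
    (e : Additive G ≃+ H) (t : B →ₗ[ℤ] A) (π : A →ₗ[ℤ] H) (hπ : Function.Surjective π)
    (h : ∀ a, π a = 0 → ∃ b, t b = a) (h' : ∀ b, π (t b) = 0) :
    minGenerators (Subgroup.closure {x : G | IsOfFinOrder x}) ≤ Module.finrank ℤ B := by
  refine le_trans ?_ (finrank_comap_torsion_le t π h h')
  let K := (Submodule.torsion ℤ H).comap π
  let F : Multiplicative K →* G :=
    AddMonoidHom.toMultiplicativeLeft
      ((e.symm : H →+ Additive G).comp (π.toAddMonoidHom.comp K.subtype.toAddMonoidHom))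
  have hF : ∀ a, F a ∈ Subgroup.closure {x : G | IsOfFinOrder x} := by
    intro a
    refine Subgroup.subset_closure ((isOfFinOrder_iff_mem_torsion e _).2 ?_)
    have : e (Additive.ofMul (F a)) = π a.toAdd.1 := e.apply_symm_apply _
    rw [this]
    exact a.toAdd.2
  refine minGenerators_le_of_surjective (F.codRestrict _ hF) ?_
  rintro ⟨x, hx⟩
  have hx' : e (Additive.ofMul x) ∈ Submodule.torsion ℤ H := by
    induction hx using Subgroup.closure_induction with
    | mem x hx => exact (isOfFinOrder_iff_mem_torsion e x).1 hx
    | one => simp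
    | mul x y _ _ hx hy => simpa using add_mem hx hy
    | inv x _ hx => simpa using hx
  obtain ⟨a, ha⟩ := hπ (e (Additive.ofMul x))
  refine ⟨Multiplicative.ofAdd ⟨a, by change π a ∈ Submodule.torsion ℤ H; rwa [ha]⟩,
    Subtype.ext ?_⟩
  have : e.symm (π a) = Additive.ofMul x := by rw [ha, e.symm_apply_apply]
  exact this

end Generators

/-! ### Rank bounds for a free complex with given homology -/

section Complexes

variable {M : ChainComplex AddCommGrpCat.{0} ℕ} (hM : IsFreeComplex M) (h : ℕ)
include hM

lemma IsFreeComplex.cycles : Module.Free ℤ (M.cycles h) ∧ Module.Finite ℤ (M.cycles h) ∧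
    Module.finrank ℤ (M.cycles h) ≤ Module.finrank ℤ (M.X h) := by
  have := (hM h).1
  have := (hM h).2
  have hi : Function.Injective (M.iCycles h).hom.toIntLinearMap :=
    (AddCommGrpCat.mono_iff_injective _).1 inferInstance
  have hfin : Module.Finite ℤ (M.cycles h) := Module.Finite.of_injective _ hi
  let e := LinearEquiv.ofInjective _ hi
  exact ⟨Module.Free.of_equiv e.symm, hfin, LinearMap.finrank_le_finrank_of_injective hi⟩

lemma IsFreeComplex.minGenerators_homology_le {G : Type} [Group G]
    (e : Additive G ≃+ M.homology h) : minGenerators G ≤ Module.finrank ℤ (M.X h) := by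
  obtain ⟨_, _, hle⟩ := hM.cycles h
  refine le_trans ?_ hle
  have hπ : Function.Surjective (M.homologyπ h).hom :=
    (AddCommGrpCat.epi_iff_surjective _).1 inferInstance
  refine minGenerators_le_of_surjective (AddMonoidHom.toMultiplicativeLeft
    ((e.symm : M.homology h →+ Additive G).comp (M.homologyπ h).hom)) ?_
  exact e.symm.surjective.comp hπ

lemma IsFreeComplex.minGenerators_torsion_homology_le {G : Type} [Group G]
    (e : Additive G ≃+ M.homology h) :
    minGenerators (Subgroup.closure {x : G | IsOfFinOrder x}) ≤
      Module.finrank ℤ (M.X (h + 1)) := by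
  obtain ⟨_, _, _⟩ := hM.cycles h
  have := (hM (h + 1)).1
  have := (hM (h + 1)).2
  have hπ : Function.Surjective (M.homologyπ h).hom :=
    (AddCommGrpCat.epi_iff_surjective _).1 inferInstance
  have hex : (ShortComplex.mk _ _ (M.toCycles_comp_homologyπ (h + 1) h)).Exact :=
    ShortComplex.exact_of_g_is_cokernel _ (M.homologyIsCokernel (h + 1) h (by simp))
  rw [ShortComplex.ab_exact_iff] at hex
  exact minGenerators_torsion_le e (M.toCycles (h + 1) h).hom.toIntLinearMap
    (M.homologyπ h).hom.toIntLinearMap hπ hex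
    (fun b => ConcreteCategory.congr_hom (M.toCycles_comp_homologyπ (h + 1) h) b)

end Complexes

/-! ### The filtration of the homotopy groups of a simple space -/

section Simple

variable {S : SSet.{0}} {x₀ : S.obj (op (SimplexCategory.mk 0))}

lemma piFiltration_succ_eq_bot (hS : IsSimpleSpace S x₀) {m : ℕ} (hm : 1 ≤ m) (i : ℕ) :
    piFiltration S x₀ m (i + 1) = ⊥ := by
  rw [piFiltration, Subgroup.closure_eq_bot_iff]
  rintro _ ⟨γ, x, y, -, hxy, rfl⟩
  rw [hS m hm γ x y hxy]
  exact mul_inv_cancel _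

lemma subsingleton_piGraded_succ (hS : IsSimpleSpace S x₀) {m : ℕ} (hm : 1 ≤ m) (i : ℕ) :
    Subsingleton (piGraded S x₀ m (i + 1)) := by
  have : Subsingleton (piFiltration S x₀ m (i + 1)) := by
    rw [piFiltration_succ_eq_bot hS hm]
    infer_instance
  exact Quotient.instSubsingletonQuotient _

lemma subsingleton_piGraded {m : ℕ} [Subsingleton (SimplicialPi S x₀ m)] (i : ℕ) :
    Subsingleton (piGraded S x₀ m i) :=
  Quotient.instSubsingletonQuotient _

lemma piGenCount_eq (hS : IsSimpleSpace S x₀) {m : ℕ} (hm : 1 ≤ m) :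
    piGenCount S x₀ m = minGenerators (piGraded S x₀ m 0) := by
  refine finsum_eq_single _ 0 fun i hi => ?_
  obtain ⟨i, rfl⟩ := Nat.exists_eq_succ_of_ne_zero hi
  have := subsingleton_piGraded_succ hS hm i
  exact minGenerators_of_subsingleton _

lemma piTorsionGenCount_eq (hS : IsSimpleSpace S x₀) {m : ℕ} (hm : 1 ≤ m) :
    piTorsionGenCount S x₀ m =
      minGenerators (Subgroup.closure {x : piGraded S x₀ m 0 | IsOfFinOrder x}) := by
  refine finsum_eq_single _ 0 fun i hi => ?_
  obtain ⟨i, rfl⟩ := Nat.exists_eq_succ_of_ne_zero hi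
  have := subsingleton_piGraded_succ hS hm i
  exact minGenerators_of_subsingleton _

end Simple

/-! ### Layers of a minimal tower and maps between stages -/

section MinimalTowers

open Simplicial

/-- Forces equality in the chain "sum of t ≤ sum of a over the image of ν ≤ sum of a over I". -/
lemma Finset.eq_and_eq_zero_of_sum_eq {α β : Type*} [DecidableEq α] {I : Finset α} {F : Finset β}
    {ν : β → α} {a : α → ℕ} {t : β → ℕ} (hν : Set.InjOn ν F) (hI : F.image ν ⊆ I)
    (hle : ∀ m ∈ F, t m ≤ a (ν m)) (h : ∑ n ∈ I, a n = ∑ m ∈ F, t m) :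
    (∀ m ∈ F, t m = a (ν m)) ∧ ∀ n ∈ I, n ∉ F.image ν → a n = 0 := by
  have h₁ := Finset.sum_sdiff (f := a) hI
  rw [Finset.sum_image hν] at h₁
  have h₂ := Finset.sum_le_sum hle
  refine ⟨(Finset.sum_eq_sum_iff_of_le hle).1 (by omega), fun n hn hn' => ?_⟩
  have h₃ : ∑ n ∈ I \ F.image ν, a n = 0 := by omega
  exact Finset.sum_eq_zero_iff.1 h₃ n (Finset.mem_sdiff.2 ⟨hn, hn'⟩)

lemma minimalRanks_eq_zero (X : SimplicialObject NumCat) {m k : ℕ} (h : k ≠ m) (h' : k ≠ m + 1) :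
    minimalRanks X m k = 0 := by
  rw [minimalRanks, if_neg h, if_neg h']

lemma finsum_gammaRank_minimalRanks (X : SimplicialObject NumCat) (j : ℕ) :
    ∑ᶠ m : ℕ, gammaRank (minimalRanks X (m + 1)) j =
      ∑ m ∈ Finset.range j, gammaRank (minimalRanks X (m + 1)) j := by
  refine finsum_eq_sum_of_support_subset _ fun m hm => ?_
  rw [Finset.coe_range, Set.mem_Iio]
  by_contra! hle
  exact hm (gammaRank_eq_zero j fun k hk => minimalRanks_eq_zero X (by omega) (by omega))

namespace SpecialTower

variable {X : SimplicialObject NumCat} (T : SpecialTower X)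

/-- If no layer has degree m + 1 and filtration index 0, every layer has zero homology in degree m +
1, since the later filtration quotients of a simple space are trivial. Then π_{m+1} is trivial. -/
lemma minimalRanks_eq_zero_or_exists_layer (hX : IsSimpleSpace (underlyingSSet X) (baseVertex X))
    (m : ℕ) : (∀ k, minimalRanks X (m + 1) k = 0) ∨
      ∃ n, T.h n = m + 1 ∧
        ∀ k, minimalRanks X (m + 1) k ≤ Module.finrank ℤ ((T.M n).X k) := by
  by_cases hn : ∃ n, T.h n = m + 1 ∧ T.i n = 0
  · right
    obtain ⟨n, hn, hi⟩ := hn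
    refine ⟨n, hn, fun k => ?_⟩
    obtain ⟨e⟩ := T.homology_iso n
    rw [hi, hn] at e
    rw [minimalRanks, piGenCount_eq hX (Nat.le_add_left 1 m),
      piTorsionGenCount_eq hX (Nat.le_add_left 1 m)]
    split_ifs with h h'
    · rw [h]
      exact (T.free n).minGenerators_homology_le _ e
    · rw [h']
      exact (T.free n).minGenerators_torsion_homology_le _ e
    · exact Nat.zero_le _
  · left
    have hM : ∀ n, Limits.IsZero ((T.M n).homology (m + 1)) := by
      intro n
      by_cases h : T.h n = m + 1
      · obtain ⟨i, hi⟩ := Nat.exists_eq_succ_of_ne_zero fun h0 => hn ⟨n, h, h0⟩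
        obtain ⟨e⟩ := T.homology_iso n
        rw [hi, h] at e
        have := subsingleton_piGraded_succ hX (Nat.le_add_left 1 m) i
        have : Subsingleton ((T.M n).homology (m + 1)) :=
          e.symm.toEquiv.trans Additive.toMul |>.subsingleton
        exact AddCommGrpCat.isZero_of_subsingleton _
      · exact T.homology_eq_zero n _ (Ne.symm h)
    have := T.toFibredTower.subsingleton_simplicialPi m hM
    have := subsingleton_piGraded (S := underlyingSSet X) (x₀ := baseVertex X) (m := m + 1) 0
    intro k
    rw [minimalRanks, piGenCount_eq hX (Nat.le_add_left 1 m),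
      piTorsionGenCount_eq hX (Nat.le_add_left 1 m), minGenerators_of_subsingleton,
      minGenerators_of_subsingleton, ite_self, ite_self]

/-- The layers of a minimal tower of a simple space are concentrated in two degrees. -/
lemma isZero_M_X (hX : IsMinimalSpace X)
    (hXs : IsSimpleSpace (underlyingSSet X) (baseVertex X)) (n j : ℕ) (hj : j ≠ T.h n)
    (hj' : j ≠ T.h n + 1) : Limits.IsZero ((T.M n).X j) := by
  classical
  let r : ℕ → ℕ → ℕ := fun n k => Module.finrank ℤ ((T.M n).X k)
  suffices h : r n j = 0 by
    have := (T.free n j).1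
    have := (T.free n j).2
    have : Subsingleton ((T.M n).X j) := Module.finrank_zero_iff.1 h
    exact AddCommGrpCat.isZero_of_subsingleton _
  let A : ℕ → Prop := fun m => ∃ n, T.h n = m + 1 ∧ ∀ k, minimalRanks X (m + 1) k ≤ r n k
  -- The layer chosen for π_{m+1}. The default 0 is harmless, as ν is used only where `A` holds.
  let ν : ℕ → ℕ := fun m => if h : A m then h.choose else 0
  have hν : ∀ m, A m → T.h (ν m) = m + 1 ∧ ∀ k, minimalRanks X (m + 1) k ≤ r (ν m) k := by
    intro m hm
    simp only [ν, dif_pos hm]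
    exact hm.choose_spec
  let F := (Finset.range j).filter A
  have hF : ∀ m ∈ F, A m := fun m hm => (Finset.mem_filter.1 hm).2
  obtain ⟨N, hN⟩ := T.exists_finrank_eq j
  obtain ⟨N', hN'⟩ : ∃ N', N ≤ N' ∧ n < N' ∧ ∀ m ∈ F, ν m < N' :=
    ⟨N + (n + 1) + ((F.image ν).sup id + 1), by omega, by omega, fun m hm => by
      have := Finset.le_sup (f := id) (Finset.mem_image_of_mem ν hm)
      simp only [id] at this
      omega⟩
  have hsum : ∑ i ∈ Finset.range N', gammaRank (r i) j =
      ∑ m ∈ F, gammaRank (minimalRanks X (m + 1)) j := by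
    rw [← hN N' hN'.1, hX.2 j, finsum_gammaRank_minimalRanks, Finset.sum_filter_of_ne]
    intro m _ hm
    refine (T.minimalRanks_eq_zero_or_exists_layer hXs m).resolve_left fun h0 => hm ?_
    exact gammaRank_eq_zero j fun k _ => h0 k
  have key := Finset.eq_and_eq_zero_of_sum_eq
    (fun m hm m' hm' h => by
      have h₁ := (hν m (hF m hm)).1
      have h₂ := (hν m' (hF m' hm')).1
      rw [h] at h₁
      omega)
    (Finset.image_subset_iff.2 fun m hm => Finset.mem_range.2 (hN'.2.2 m hm))
    (fun m hm => gammaRank_mono (hν m (hF m hm)).2 j) hsum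
  -- A chosen layer has rank τ_{m+1}(j) in degree j, which is 0 because j is neither h_n nor h_n +
  -- 1; any other layer contributes nothing in dimension j.
  by_cases hn : n ∈ F.image ν
  · obtain ⟨m, hm, rfl⟩ := Finset.mem_image.1 hn
    have h₁ := (hν m (hF m hm)).1
    rw [← eq_of_gammaRank_eq (hν m (hF m hm)).2 j (key.1 m hm)]
    exact minimalRanks_eq_zero X (by omega) (by omega)
  · refine (eq_of_gammaRank_eq (r := fun _ => 0) (fun _ => Nat.zero_le _) j ?_).symm
    rw [key.2 n (Finset.mem_range.2 hN'.2.1) hn]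
    exact gammaRank_eq_zero j fun _ _ => rfl

end SpecialTower

namespace FibredTower

variable {X : SimplicialObject NumCat} (T : FibredTower X)

/-- A simplex of `X^b` is determined by its faces of dimension `≤ H`. -/
lemma stage_ext (H b : ℕ)
    (h : ∀ n < b, ∀ q, H ≤ q → Limits.IsZero ((T.M n).homology (q + 1)))
    (h' : ∀ n < b, ∀ q, H ≤ q → Limits.IsZero ((T.M n).X (q + 2)))
    (q : ℕ) (y y' : (T.stage b) _⦋q⦌)
    (hy : ∀ p ≤ H, ∀ f : ⦋p⦌ ⟶ ⦋q⦌,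
      ((T.stage b).map f.op).toFun y = ((T.stage b).map f.op).toFun y') : y = y' := by
  induction b generalizing q with
  | zero =>
    have := T.bottom q
    exact Subsingleton.elim _ _
  | succ b ihb =>
    have hb : ∀ (q : ℕ) (y y' : (T.stage (b + 1)) _⦋q⦌),
        (∀ p ≤ H, ∀ f : ⦋p⦌ ⟶ ⦋q⦌, ((T.stage (b + 1)).map f.op).toFun y =
          ((T.stage (b + 1)).map f.op).toFun y') →
        ((T.bond b).app (op ⦋q⦌)).toFun y = ((T.bond b).app (op ⦋q⦌)).toFun y' := by
      intro q y y' hy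
      refine ihb (fun n hn => h n (by omega)) (fun n hn => h' n (by omega)) q _ _ fun p hp f => ?_
      rw [← NumCat.naturality_apply, ← NumCat.naturality_apply, hy p hp f]
    induction q with
    | zero => exact Subsingleton.elim _ _
    | succ q ihq =>
      rcases Nat.lt_or_ge q H with hq | hq
      · have := hy (q + 1) hq (𝟙 _)
        rw [op_id, CategoryTheory.Functor.map_id] at this
        exact this
      -- Above dimension H the two simplices agree in the base and, by induction on q, on faces, so
      -- they differ by a fibre simplex with zero faces.
      · refine (T.ptcp b).some.eq_of_faces_eq (hb _ _ _ hy) (fun i => ?_)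
          (dkGamma_eq_zero_of_all_faces _ q (h b b.lt_succ_self q hq) (h' b b.lt_succ_self q hq))
        refine ihq _ _ fun p hp f => ?_
        have := hy p hp (f ≫ SimplexCategory.δ i)
        rw [op_comp, Functor.map_comp] at this
        exact this

end FibredTower

/-- Composing g with arbitrary dimensionwise sections suffices: the sections need not be simplicial,
since naturality can be checked after the split epimorphisms p. -/
lemma existsUnique_factorization {X A B : SimplicialObject NumCat} (p : X ⟶ A) (g : X ⟶ B)
    (hp : ∀ q : ℕ, IsSplitEpi (p.app (op ⦋q⦌)))
    (h : ∀ (q : ℕ) (x x' : X _⦋q⦌), (p.app (op ⦋q⦌)).toFun x = (p.app (op ⦋q⦌)).toFun x' →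
      (g.app (op ⦋q⦌)).toFun x = (g.app (op ⦋q⦌)).toFun x') :
    ∃! φ : A ⟶ B, p ≫ φ = g := by
  have hp' : ∀ q : SimplexCategoryᵒᵖ, IsSplitEpi (p.app q) := fun q => hp q.unop.len
  have hfac : ∀ q : SimplexCategoryᵒᵖ, p.app q ≫ section_ (p.app q) ≫ g.app q = g.app q := by
    intro q
    refine NumCat.Hom.ext (funext fun x => h q.unop.len _ x ?_)
    exact congrFun (congrArg NumCat.Hom.toFun (IsSplitEpi.id (p.app q))) _
  refine ⟨{ app := fun q => section_ (p.app q) ≫ g.app q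
            naturality := fun q r f => ?_ }, ?_, fun ψ hψ => ?_⟩
  · rw [← cancel_epi (p.app q), ← NatTrans.naturality_assoc, hfac, NatTrans.naturality,
      ← Category.assoc (p.app q), hfac]
  · exact NatTrans.ext (funext hfac)
  · refine NatTrans.ext (funext fun q => ?_)
    rw [← cancel_epi (p.app q), hfac, ← hψ, NatTrans.comp_app]

lemma existsUnique_stage_map {X Y : SimplicialObject NumCat}
    (hX : IsMinimalSpace X) (hY : IsMinimalSpace Y)
    (hXs : IsSimpleSpace (underlyingSSet X) (baseVertex X))
    (hYs : IsSimpleSpace (underlyingSSet Y) (baseVertex Y))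
    (TX : SpecialTower X) (TY : SpecialTower Y) (f : X ⟶ Y) (a b : ℕ)
    (hab : ∀ j k : ℕ, a ≤ j → k < b → TY.h k < TX.h j) :
    ∃! φ : TX.stage a ⟶ TY.stage b, TX.proj a ≫ φ = f ≫ TY.proj b := by
  refine existsUnique_factorization _ _ (fun q => TX.isSplitEpi_proj a q) fun q x x' hx => ?_
  let H := (Finset.range b).sup TY.h
  have hH : ∀ k < b, TY.h k ≤ H := fun k hk => Finset.le_sup (f := TY.h) (Finset.mem_range.2 hk)
  -- For b = 0 the supremum is 0, and the strict inequality comes from `h_pos`.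
  have hH' : ∀ j, a ≤ j → H < TX.h j := fun j hj =>
    (Finset.sup_lt_iff (TX.h_pos j)).2 fun k hk => hab j k hj (Finset.mem_range.1 hk)
  refine TY.stage_ext H b
    (fun n hn q hq => TY.homology_eq_zero n _ (by have := hH n hn; omega))
    (fun n hn q hq => TY.isZero_M_X hY hYs n _ (by have := hH n hn; omega)
      (by have := hH n hn; omega)) q _ _ fun p hp g => ?_
  -- Faces of dimension p ≤ H are detected in X^a, because the layers of X from stage a on are
  -- trivial in those dimensions.
  have hg : (X.map g.op).toFun x = (X.map g.op).toFun x' := by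
    refine TX.proj_injective_of_subsingleton a p (fun n hn => ?_) ?_
    · refine subsingleton_dkGamma p fun k hk => ?_
      have := hH' n hn
      exact AddCommGrpCat.subsingleton_of_isZero
        (TX.isZero_M_X hX hXs n k (by omega) (by omega))
    · rw [NumCat.naturality_apply, NumCat.naturality_apply, hx]
  rw [← NumCat.naturality_apply, ← NumCat.naturality_apply, hg]

end MinimalTowers

theorem mainTheorem6 {X Y : SimplicialObject NumCat}
    (hX : IsMinimalSpace X) (hY : IsMinimalSpace Y)
    (hXs : IsSimpleSpace (underlyingSSet X) (baseVertex X))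
    (hYs : IsSimpleSpace (underlyingSSet Y) (baseVertex Y))
    (TX : SpecialTower X) (TY : SpecialTower Y) (f : X ⟶ Y) :
    (∀ a b : ℕ, (∀ j k : ℕ, a ≤ j → k < b → TY.h k < TX.h j) →
      ∃! φ : TX.stage a ⟶ TY.stage b, TX.proj a ≫ φ = f ≫ TY.proj b) ∧
    ((∀ j k : ℕ, k < j → TY.h k < TX.h j) →
      ∃! φ : TX.tower ⟶ TY.tower, ∀ n : ℕ, TX.proj n ≫ φ.app (op n) = f ≫ TY.proj n) := by
  refine ⟨existsUnique_stage_map hX hY hXs hYs TX TY f, fun h => ?_⟩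
  -- The tower map is the case a = b = n of the stagewise statement; its naturality follows by
  -- cancelling the epimorphisms X → X^m.
  have hstage := fun n => existsUnique_stage_map hX hY hXs hYs TX TY f n n
    fun j k hj hk => h j k (by omega)
  choose φ hφ hφ' using hstage
  have hepi : ∀ n, Epi (TX.proj n) := by
    intro n
    have : ∀ q : SimplexCategoryᵒᵖ, Epi ((TX.proj n).app q) := fun q => by
      have : IsSplitEpi ((TX.proj n).app q) := TX.isSplitEpi_proj n q.unop.len
      infer_instance
    exact NatTrans.epi_of_epi_app _
  refine ⟨{ app := fun n => φ n.unop
            naturality := fun m n g => ?_ }, fun n => hφ n, fun ψ hψ => ?_⟩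
  · obtain ⟨m, rfl⟩ : ∃ k, m = op k := ⟨m.unop, rfl⟩
    obtain ⟨n, rfl⟩ : ∃ k, n = op k := ⟨n.unop, rfl⟩
    have := hepi m
    rw [← cancel_epi (TX.proj m)]
    have h₁ := hφ m
    have h₂ := hφ n
    dsimp only at h₁ h₂ ⊢
    rw [← Category.assoc, TX.proj_map g, h₂, ← Category.assoc, h₁, Category.assoc, TY.proj_map g]
  · refine NatTrans.ext (funext fun n => ?_)
    exact hφ' n.unop _ (hψ n.unop)
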